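/- Let $\alpha\in(0,2)$ and let $(\varepsilon_t)_{t\in\mathbb Z}$ be i.i.d. symmetric $\alpha$-stable random variables with $E e^{\mathrm i s\varepsilon_t}=e^{-|s|^\alpha}$, $s\in\mathbb R$. Let $(\psi_j)_{j\in\mathbb Z}$ be real numbers such that, for some $\tau>0$, $$\sum_{j=-\infty}^{\infty}|\psi_j|\,|j|^{2/\alpha}\,(1+\log^+|j|)^{\frac{4-\alpha}{2\alpha}+\tau}<\infty .$$ Put $X_t=\sum_{j\in\mathbb Z}\psi_j\varepsilon_{t-j}$ for $t\in\mathbb Z$ and $\psi(e^{-\mathrm ix})=\sum_{j\in\mathbb Z}\psi_je^{-\mathrm ixj}$. For a real sequence $Y=(Y_t)$ let $$I_{n,Y}(x)=\Bigl|\frac1{\sqrt n}\sum_{t=1}^n e^{-\mathrm ixt}Y_t\Bigr|^2,\qquad x\in[0,\pi],$$ be its periodogram, and define the remainder $R_n$ by $$I_{n,X}(x)=I_{n,\varepsilon}(x)\,|\psi(e^{-\mathrm ix})|^2+R_n(x).$$ Let $\mathcal F$ be a collection of (measurable) real-valued functions on $[0,\pi]$ with $\sup_{f\in\mathcal F}\|f\|_2<\infty$,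 where $\|\cdot\|_2$ is the norm of $L^2[0,\pi]$. Then the series defining $X_t$ converges absolutely with probability one for every $t$, the series defining $\psi(e^{-\mathrm ix})$ converges absolutely for every $x$, the functions $fR_n$, $f\in\mathcal F$, are integrable on $[0,\pi]$, and $$\frac{n}{(n\log n)^{1/\alpha}}\ \sup_{f\in\mathcal F}\Bigl|\int_0^{\pi}f(x)R_n(x)\,\mathrm dx\Bigr|\ \xrightarrow{\;P\;}\ 0\qquad(n\to\infty).$$ -/

import Mathlib

noncomputable section

namespace LinearProcess

open MeasureTheory

/-- `Y` has the symmetric `α`-stable law with unit scale: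
its characteristic function is `s ↦ exp (-|s| ^ α)`. -/
def HasStdSymmStableLaw {Ω : Type*} [MeasurableSpace Ω] (α : ℝ) (Y : Ω → ℝ)
    (P : Measure Ω) : Prop :=
  ∀ s : ℝ, charFun (P.map Y) s = ((Real.exp (-(|s| ^ α)) : ℝ) : ℂ)

/-- The linear (two-sided moving average) sequence `X_t = ∑_{j ∈ ℤ} ψ_j e_{t-j}`
driven by the sequence `e`. -/
def linearFilter (ψ : ℤ → ℝ) (e : ℤ → ℝ) (t : ℤ) : ℝ :=
  ∑' j : ℤ, ψ j * e (t - j)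

/-- The transfer function `ψ(e^{-ix}) = ∑_{j ∈ ℤ} ψ_j e^{-ixj}`, as a function of `x`. -/
def transfer (ψ : ℤ → ℝ) (x : ℝ) : ℂ :=
  ∑' j : ℤ, (ψ j : ℂ) * Complex.exp (-(Complex.I * x * j))

/-- The periodogram `I_n(x) = |n^{-1/2} ∑_{t=1}^n e^{-ixt} y_t|²` of `y_1, …, y_n`. -/
def periodogram (n : ℕ) (y : ℤ → ℝ) (x : ℝ) : ℝ :=
  ‖(1 / (Real.sqrt n : ℂ)) *
    ∑ t ∈ Finset.Icc (1 : ℤ) n, Complex.exp (-(Complex.I * x * t)) * (y t : ℂ)‖ ^ 2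

/-- The remainder `R_n(x) = I_{n,X}(x) - I_{n,e}(x) |ψ(e^{-ix})|²`,
where `X` is the linear sequence with coefficients `ψ` driven by `e`. -/
def remainder (n : ℕ) (ψ : ℤ → ℝ) (e : ℤ → ℝ) (x : ℝ) : ℝ :=
  periodogram n (linearFilter ψ e) x - periodogram n e x * ‖transfer ψ x‖ ^ 2

end LinearProcess

end

noncomputable section

namespace LinearProcess

open MeasureTheory
open scoped ENNReal

/-! Filtering multiplies the Fourier sum S of the noise by ψ(e^{-ix}), except for edge effects:
shifting the window by j alters only |j| terms at each end. Summed against ψ, this gives an error at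
most `edgeSum`, uniformly in x. Its coefficients c_k are O(k^{-2/α}), so for α/2 < β < min(α, 1) the
series ∑ c_k^β converges. Since y ↦ y^β is subadditive and ε_t has finite moments below α, `edgeSum`
has a β-th moment bounded in n, hence is O_P(1) (`measure_lt_edgeSum_le`).

Thus |R_n| ≤ n⁻¹(2A·L·|S| + L²), where L bounds `edgeSum` and A = ∑|ψ_j|. By Parseval ∫|S|² is of
the order of ∑ε_t², which is O_P(n^{2/α}) (`measure_lt_sum_sq_le`), so ‖R_n‖₂ = O_P(n^{1/α-1}).
Cauchy–Schwarz makes this uniform over a class bounded in L², and the normalisation leaves O_P((log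
n)^{-1/α}). -/

/-- The tail sums `c_k = ∑_{|j| > k} |ψ_j|` of the filter coefficients. -/
def tailWeight (ψ : ℤ → ℝ) (k : ℕ) : ℝ≥0∞ :=
  ∑' j : ℤ, if k < j.natAbs then ‖ψ j‖ₑ else 0

/-- The four entries of a sequence at distance `k` from the ends of the window `1, …, n`. -/
def edgeTerm (n : ℕ) (e : ℤ → ℝ) (k : ℕ) : ℝ≥0∞ :=
  ‖e (-k)‖ₑ + ‖e (n - k)‖ₑ + (‖e (1 + k)‖ₑ + ‖e (n + 1 + k)‖ₑ)

/-- A majorant, uniform in the frequency, of the error made when the Fourier sum of the filtered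
sequence is replaced by the transfer function times the Fourier sum of the input. -/
def edgeSum (n : ℕ) (ψ : ℤ → ℝ) (e : ℤ → ℝ) : ℝ≥0∞ :=
  ∑' k : ℕ, tailWeight ψ k * edgeTerm n e k

/-- The unnormalised Fourier sum `∑_{t=1}^n e^{-ixt} y_t`. -/
def fourierSum (n : ℕ) (y : ℤ → ℝ) (x : ℝ) : ℂ :=
  ∑ t ∈ Finset.Icc (1 : ℤ) n, Complex.exp (-(Complex.I * x * t)) * (y t : ℂ)

/-! ### Edge effects of filtering on the Fourier sum -/

lemma norm_exp_neg_I_mul (x : ℝ) (t : ℤ) : ‖Complex.exp (-(Complex.I * x * t))‖ = 1 := by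
  have : -(Complex.I * x * t) = ((-(x * t) : ℝ) : ℂ) * Complex.I := by push_cast; ring
  rw [this, Complex.norm_exp_ofReal_mul_I]

lemma sum_Icc_one_eq_sum_range {M : Type*} [AddCommMonoid M] (g : ℤ → M) (n : ℕ) :
    ∑ t ∈ Finset.Icc (1 : ℤ) n, g t = ∑ i ∈ Finset.range n, g (i + 1) := by
  symm
  refine Finset.sum_bij (fun i _ => (i : ℤ) + 1) ?_ ?_ ?_ ?_
  · intro i hi
    simp only [Finset.mem_range] at hi
    simp only [Finset.mem_Icc]
    omega
  · intro a _ b _ h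
    simpa using h
  · intro b hb
    simp only [Finset.mem_Icc] at hb
    exact ⟨(b - 1).toNat, by simp only [Finset.mem_range]; omega, by omega⟩
  · intros; rfl

/-- Each further unit shift changes the window sum by one entering and one leaving term, by
telescoping. -/
lemma enorm_sum_shift_sub_le_left (g : ℤ → ℂ) (n m : ℕ) :
    ‖∑ t ∈ Finset.Icc (1 : ℤ) n, g (t - m) - ∑ t ∈ Finset.Icc (1 : ℤ) n, g t‖ₑ
      ≤ ∑ k ∈ Finset.range m, (‖g (-k)‖ₑ + ‖g (n - k)‖ₑ) := by
  induction m with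
  | zero => simp
  | succ m ih =>
    have key : ∑ t ∈ Finset.Icc (1 : ℤ) n, g (t - (m + 1 : ℕ))
        - ∑ t ∈ Finset.Icc (1 : ℤ) n, g (t - m) = g (-m) - g (n - m) := by
      rw [sum_Icc_one_eq_sum_range (fun t => g (t - (m + 1 : ℕ))),
        sum_Icc_one_eq_sum_range (fun t => g (t - m)), ← Finset.sum_sub_distrib]
      have := Finset.sum_range_sub' (fun i : ℕ => g ((i : ℤ) - m)) n
      simp only [Nat.cast_zero, zero_sub] at this
      rw [← this]
      refine Finset.sum_congr rfl fun i _ => ?_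
      congr 2
      push_cast; ring
    rw [Finset.sum_range_succ]
    calc _ = ‖(∑ t ∈ Finset.Icc (1 : ℤ) n, g (t - m) - ∑ t ∈ Finset.Icc (1 : ℤ) n, g t)
          + (g (-m) - g (n - m))‖ₑ := by rw [← key]; congr 1; ring
      _ ≤ _ := (enorm_add_le _ _).trans (add_le_add ih (enorm_sub_le))

lemma enorm_sum_shift_sub_le_right (g : ℤ → ℂ) (n m : ℕ) :
    ‖∑ t ∈ Finset.Icc (1 : ℤ) n, g (t + m) - ∑ t ∈ Finset.Icc (1 : ℤ) n, g t‖ₑ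
      ≤ ∑ k ∈ Finset.range m, (‖g (1 + k)‖ₑ + ‖g (n + 1 + k)‖ₑ) := by
  induction m with
  | zero => simp
  | succ m ih =>
    have key : ∑ t ∈ Finset.Icc (1 : ℤ) n, g (t + (m + 1 : ℕ))
        - ∑ t ∈ Finset.Icc (1 : ℤ) n, g (t + m) = g (n + 1 + m) - g (1 + m) := by
      rw [sum_Icc_one_eq_sum_range (fun t => g (t + (m + 1 : ℕ))),
        sum_Icc_one_eq_sum_range (fun t => g (t + m)), ← Finset.sum_sub_distrib]
      have := Finset.sum_range_sub (fun i : ℕ => g ((i : ℤ) + 1 + m)) n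
      simp only [Nat.cast_zero, zero_add] at this
      rw [← this]
      refine Finset.sum_congr rfl fun i _ => ?_
      congr 2
      push_cast; ring
    rw [Finset.sum_range_succ]
    calc _ = ‖(∑ t ∈ Finset.Icc (1 : ℤ) n, g (t + m) - ∑ t ∈ Finset.Icc (1 : ℤ) n, g t)
          + (g (n + 1 + m) - g (1 + m))‖ₑ := by rw [← key]; congr 1; ring
      _ ≤ _ := (enorm_add_le _ _).trans
        (add_le_add ih (enorm_sub_le.trans_eq (add_comm _ _)))

/-- `edgeTerm` collects the end terms of both shift directions, so one majorant serves either sign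
of j. -/
lemma enorm_sum_shift_sub_le (g : ℤ → ℂ) (e : ℤ → ℝ) (hg : ∀ t, ‖g t‖ₑ = ‖e t‖ₑ)
    (n : ℕ) (j : ℤ) :
    ‖∑ t ∈ Finset.Icc (1 : ℤ) n, g (t - j) - ∑ t ∈ Finset.Icc (1 : ℤ) n, g t‖ₑ
      ≤ ∑ k ∈ Finset.range j.natAbs, edgeTerm n e k := by
  obtain ⟨m, rfl | rfl⟩ := j.eq_nat_or_neg
  · refine (enorm_sum_shift_sub_le_left g n m).trans ?_
    rw [Int.natAbs_natCast]
    refine Finset.sum_le_sum fun k _ => ?_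
    simp only [hg, edgeTerm]
    exact le_self_add
  · simp only [sub_neg_eq_add]
    refine (enorm_sum_shift_sub_le_right g n m).trans ?_
    rw [Int.natAbs_neg, Int.natAbs_natCast]
    refine Finset.sum_le_sum fun k _ => ?_
    simp only [hg, edgeTerm]
    exact le_add_self

/-- Tonelli: the k-th edge term is charged by exactly the coefficients with |j| > k. -/
lemma tsum_enorm_mul_sum_range (ψ : ℤ → ℝ) (v : ℕ → ℝ≥0∞) :
    ∑' j : ℤ, ‖ψ j‖ₑ * ∑ k ∈ Finset.range j.natAbs, v k = ∑' k : ℕ, tailWeight ψ k * v k := by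
  have h1 : ∀ j : ℤ, ‖ψ j‖ₑ * ∑ k ∈ Finset.range j.natAbs, v k
      = ∑' k : ℕ, (if k < j.natAbs then ‖ψ j‖ₑ else 0) * v k := by
    intro j
    rw [tsum_eq_sum (s := Finset.range j.natAbs), Finset.mul_sum]
    · refine Finset.sum_congr rfl fun k hk => ?_
      rw [if_pos (Finset.mem_range.1 hk)]
    · intro k hk
      rw [if_neg (by simpa using hk), zero_mul]
  simp_rw [h1]
  rw [ENNReal.tsum_comm]
  simp_rw [ENNReal.tsum_mul_right, tailWeight]

/-- The edge effect bound: filtering commutes with the Fourier sum up to `edgeSum`. -/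
lemma enorm_fourierSum_linearFilter_sub_le {ψ e : ℤ → ℝ} (hψ : Summable ψ)
    (he : ∀ t : ℤ, Summable fun j : ℤ => ψ j * e (t - j)) (n : ℕ) (x : ℝ) :
    ‖fourierSum n (linearFilter ψ e) x - transfer ψ x * fourierSum n e x‖ₑ ≤ edgeSum n ψ e := by
  set E : ℤ → ℂ := fun t => Complex.exp (-(Complex.I * x * t)) with hE
  have hEadd : ∀ s t : ℤ, E (s + t) = E s * E t := by
    intro s t
    simp only [hE, ← Complex.exp_add]
    congr 1
    push_cast
    ring
  have hEn : ∀ t, ‖E t‖ = 1 := norm_exp_neg_I_mul x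
  have hs1 : ∀ t : ℤ, Summable fun j : ℤ => E t * ((ψ j * e (t - j) : ℝ) : ℂ) := by
    intro t
    refine Summable.mul_left _ ?_
    exact_mod_cast (he t)
  have hs2 : Summable fun j : ℤ => (ψ j : ℂ) * E j := by
    refine Summable.of_norm ?_
    simpa [hEn] using hψ.abs
  have hX : fourierSum n (linearFilter ψ e) x
      = ∑' j : ℤ, ∑ t ∈ Finset.Icc (1 : ℤ) n, E t * ((ψ j * e (t - j) : ℝ) : ℂ) := by
    rw [Summable.tsum_finsetSum fun t _ => hs1 t]
    refine Finset.sum_congr rfl fun t _ => ?_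
    rw [tsum_mul_left, linearFilter, Complex.ofReal_tsum]
  have hT : transfer ψ x * fourierSum n e x = ∑' j : ℤ, (ψ j : ℂ) * E j * fourierSum n e x := by
    rw [tsum_mul_right]
    rfl
  have hsX : Summable fun j : ℤ =>
      ∑ t ∈ Finset.Icc (1 : ℤ) n, E t * ((ψ j * e (t - j) : ℝ) : ℂ) :=
    summable_sum fun t _ => hs1 t
  rw [hX, hT, ← hsX.tsum_sub (hs2.mul_right _)]
  refine (enorm_tsum_le_tsum_enorm).trans ?_
  rw [edgeSum, ← tsum_enorm_mul_sum_range]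
  refine ENNReal.tsum_le_tsum fun j => ?_
  -- Since E t = E j · E (t - j), the j-th summand factors as ψ_j E_j times the effect of shifting g
  -- by j.
  set g : ℤ → ℂ := fun t => E t * (e t : ℂ) with hg
  have hgn : ∀ t, ‖g t‖ₑ = ‖e t‖ₑ := by
    intro t
    rw [enorm_eq_iff_norm_eq, hg, norm_mul, hEn, one_mul, Complex.norm_real]
  have : (∑ t ∈ Finset.Icc (1 : ℤ) n, E t * ((ψ j * e (t - j) : ℝ) : ℂ))
      - (ψ j : ℂ) * E j * fourierSum n e x
      = ((ψ j : ℂ) * E j) * (∑ t ∈ Finset.Icc (1 : ℤ) n, g (t - j)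
        - ∑ t ∈ Finset.Icc (1 : ℤ) n, g t) := by
    rw [mul_sub, Finset.mul_sum]
    congr 1
    refine Finset.sum_congr rfl fun t _ => ?_
    have h := hEadd j (t - j)
    rw [add_sub_cancel] at h
    simp only [hg]
    rw [h]
    push_cast
    ring
  rw [this, enorm_mul]
  have h2 : ‖(ψ j : ℂ) * E j‖ₑ = ‖ψ j‖ₑ := by
    rw [enorm_eq_iff_norm_eq, norm_mul, hEn, mul_one, Complex.norm_real]
  rw [h2]
  gcongr
  exact enorm_sum_shift_sub_le g e hgn n j

/-! ### Parseval's identity -/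

lemma intervalIntegral_exp_int_mul (m : ℤ) :
    ∫ x in (-Real.pi)..Real.pi, Complex.exp (Complex.I * x * m)
      = if m = 0 then 2 * (Real.pi : ℂ) else 0 := by
  split_ifs with h
  · subst h
    simp
    ring
  · have hc : Complex.I * (m : ℂ) ≠ 0 := mul_ne_zero Complex.I_ne_zero (by exact_mod_cast h)
    have := integral_exp_mul_complex (a := -Real.pi) (b := Real.pi) hc
    rw [show (fun x : ℝ => Complex.exp (Complex.I * x * m))
      = fun x : ℝ => Complex.exp (Complex.I * m * x) from by ext x; ring_nf, this]
    -- The two exponents differ by 2πi·m.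
    have h2 : Complex.exp (Complex.I * m * (Real.pi : ℝ))
        = Complex.exp (Complex.I * m * ((-Real.pi : ℝ) : ℂ)) := by
      rw [Complex.exp_eq_exp_iff_exists_int]
      refine ⟨m, ?_⟩
      push_cast
      ring
    rw [h2, sub_self, zero_div]

lemma continuous_fourierSum (n : ℕ) (y : ℤ → ℝ) : Continuous (fourierSum n y) := by
  unfold fourierSum
  fun_prop

/-- Parseval's identity for the Fourier sum. -/
lemma intervalIntegral_sq_norm_fourierSum (n : ℕ) (y : ℤ → ℝ) :
    ∫ x in (-Real.pi)..Real.pi, ‖fourierSum n y x‖ ^ 2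
      = 2 * Real.pi * ∑ t ∈ Finset.Icc (1 : ℤ) n, y t ^ 2 := by
  have h1 : ∀ x : ℝ, ((‖fourierSum n y x‖ ^ 2 : ℝ) : ℂ)
      = ∑ s ∈ Finset.Icc (1 : ℤ) n, ∑ t ∈ Finset.Icc (1 : ℤ) n,
        ((y s : ℂ) * y t) * Complex.exp (Complex.I * x * ((t - s : ℤ) : ℂ)) := by
    intro x
    rw [← Complex.normSq_eq_norm_sq, Complex.normSq_eq_conj_mul_self, mul_comm, fourierSum,
      map_sum, Finset.sum_mul_sum]
    refine Finset.sum_congr rfl fun s _ => Finset.sum_congr rfl fun t _ => ?_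
    rw [map_mul, ← Complex.exp_conj, Complex.conj_ofReal]
    have : (starRingEnd ℂ) (-(Complex.I * x * t)) = Complex.I * x * t := by
      simp
    rw [this, show Complex.I * x * ((t - s : ℤ) : ℂ)
      = -(Complex.I * x * s) + Complex.I * x * t by push_cast; ring, Complex.exp_add]
    ring
  have h2 : ((∫ x in (-Real.pi)..Real.pi, ‖fourierSum n y x‖ ^ 2 : ℝ) : ℂ)
      = ((2 * Real.pi * ∑ t ∈ Finset.Icc (1 : ℤ) n, y t ^ 2 : ℝ) : ℂ) := by
    rw [← intervalIntegral.integral_ofReal]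
    simp_rw [h1]
    rw [intervalIntegral.integral_finsetSum]
    · simp only [Complex.ofReal_mul, Complex.ofReal_sum, Complex.ofReal_pow, Complex.ofReal_ofNat]
      rw [Finset.mul_sum]
      refine Finset.sum_congr rfl fun s hs => ?_
      rw [intervalIntegral.integral_finsetSum]
      · simp_rw [intervalIntegral.integral_const_mul, intervalIntegral_exp_int_mul, sub_eq_zero]
        simp only [mul_ite, mul_zero]
        rw [Finset.sum_ite_eq' (Finset.Icc (1 : ℤ) n) s, if_pos hs]
        ring
      · intro t _
        exact Continuous.intervalIntegrable (by fun_prop) _ _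
    · intro s _
      exact Continuous.intervalIntegrable (by fun_prop) _ _
  exact_mod_cast h2

lemma intervalIntegral_sq_norm_fourierSum_le (n : ℕ) (y : ℤ → ℝ) :
    ∫ x in (0 : ℝ)..Real.pi, ‖fourierSum n y x‖ ^ 2
      ≤ 2 * Real.pi * ∑ t ∈ Finset.Icc (1 : ℤ) n, y t ^ 2 := by
  rw [← intervalIntegral_sq_norm_fourierSum]
  have := Real.pi_pos
  refine intervalIntegral.integral_mono_interval (by linarith) this.le le_rfl ?_ ?_
  · exact Filter.Eventually.of_forall fun x => by positivity
  · exact ((continuous_fourierSum n y).norm.pow 2).intervalIntegrable _ _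

/-! ### Transfer function and L² bound for the remainder -/

lemma summable_transfer {ψ : ℤ → ℝ} (hψ : Summable ψ) (x : ℝ) :
    Summable fun j : ℤ => (ψ j : ℂ) * Complex.exp (-(Complex.I * x * j)) := by
  refine Summable.of_norm ?_
  simpa [norm_mul, norm_exp_neg_I_mul] using hψ.abs

lemma norm_transfer_le {ψ : ℤ → ℝ} (hψ : Summable ψ) (x : ℝ) :
    ‖transfer ψ x‖ ≤ ∑' j, |ψ j| := by
  have h := norm_tsum_le_tsum_norm (summable_transfer hψ x).norm
  rw [← transfer] at h
  simpa only [norm_mul, norm_exp_neg_I_mul, mul_one, Complex.norm_real, Real.norm_eq_abs] using h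

lemma continuous_transfer {ψ : ℤ → ℝ} (hψ : Summable ψ) : Continuous (transfer ψ) := by
  refine continuous_tsum (u := fun j => |ψ j|) (fun j => by fun_prop) hψ.abs fun j x => ?_
  rw [norm_mul, norm_exp_neg_I_mul, mul_one, Complex.norm_real, Real.norm_eq_abs]

lemma periodogram_eq (n : ℕ) (y : ℤ → ℝ) (x : ℝ) :
    periodogram n y x = (n : ℝ)⁻¹ * ‖fourierSum n y x‖ ^ 2 := by
  rw [periodogram, ← fourierSum, norm_mul, mul_pow]
  congr 1
  rw [norm_div, norm_one, Complex.norm_real, Real.norm_eq_abs, div_pow, sq_abs,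
    Real.sq_sqrt n.cast_nonneg, one_pow, one_div]

/-- For fixed n the Fourier sums are trigonometric polynomials, whatever values `linearFilter`
takes, including the default 0 where its series diverges. Hence no exceptional null set is needed.
-/
lemma continuous_remainder {ψ : ℤ → ℝ} (hψ : Summable ψ) (n : ℕ) (e : ℤ → ℝ) :
    Continuous (remainder n ψ e) := by
  unfold remainder
  simp_rw [periodogram_eq]
  have h1 := continuous_fourierSum n (linearFilter ψ e)
  have h2 := continuous_fourierSum n e
  have h3 := continuous_transfer hψ
  fun_prop

/-- With |a − b| ≤ L one has ||a|² − |b|²| ≤ L(2|b| + L), applied to b = ψ(e^{-ix})S. -/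
lemma abs_remainder_le {ψ e : ℤ → ℝ} (hψ : Summable ψ)
    (he : ∀ t : ℤ, Summable fun j : ℤ => ψ j * e (t - j)) (n : ℕ) {L : ℝ} (hL : 0 ≤ L)
    (hB : edgeSum n ψ e ≤ ENNReal.ofReal L) (x : ℝ) :
    |remainder n ψ e x|
      ≤ (n : ℝ)⁻¹ * (2 * (∑' j, |ψ j|) * L * ‖fourierSum n e x‖ + L ^ 2) := by
  have hD : ‖fourierSum n (linearFilter ψ e) x - transfer ψ x * fourierSum n e x‖ ≤ L := by
    have := (enorm_fourierSum_linearFilter_sub_le hψ he n x).trans hB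
    rwa [← ofReal_norm, ENNReal.ofReal_le_ofReal_iff hL] at this
  have hA := norm_transfer_le hψ x
  set a := fourierSum n (linearFilter ψ e) x
  set S := fourierSum n e x
  set T := transfer ψ x
  have h1 : ‖a‖ ≤ ‖T * S‖ + L := by
    linarith [norm_sub_norm_le a (T * S)]
  have h2 : ‖T * S‖ ≤ ‖a‖ + L := by
    have := norm_sub_norm_le (T * S) a
    rw [norm_sub_rev] at this
    linarith
  have h3 : ‖T * S‖ ≤ (∑' j, |ψ j|) * ‖S‖ := by
    rw [norm_mul]
    gcongr
  rw [remainder, periodogram_eq, periodogram_eq,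
    show (n : ℝ)⁻¹ * ‖a‖ ^ 2 - (n : ℝ)⁻¹ * ‖S‖ ^ 2 * ‖T‖ ^ 2
      = (n : ℝ)⁻¹ * (‖a‖ ^ 2 - ‖T * S‖ ^ 2) by rw [norm_mul]; ring, abs_mul,
    abs_of_nonneg (by positivity : (0 : ℝ) ≤ (n : ℝ)⁻¹)]
  gcongr
  have h4 := norm_nonneg a
  have h5 := norm_nonneg (T * S)
  rw [abs_le]
  constructor <;> nlinarith

lemma intervalIntegral_sq_remainder_le {ψ e : ℤ → ℝ} (hψ : Summable ψ)
    (he : ∀ t : ℤ, Summable fun j : ℤ => ψ j * e (t - j)) (n : ℕ) {L : ℝ} (hL : 0 ≤ L)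
    (hB : edgeSum n ψ e ≤ ENNReal.ofReal L) :
    ∫ x in (0 : ℝ)..Real.pi, remainder n ψ e x ^ 2
      ≤ ((n : ℝ)⁻¹) ^ 2 * (16 * Real.pi * (L ^ 2 * (∑' j, |ψ j|) ^ 2
        * ∑ t ∈ Finset.Icc (1 : ℤ) n, e t ^ 2 + L ^ 4)) := by
  set A := ∑' j, |ψ j|
  have hπ := Real.pi_pos
  have hc := continuous_fourierSum n e
  have hpt : ∀ x, remainder n ψ e x ^ 2
      ≤ ((n : ℝ)⁻¹) ^ 2 * (8 * A ^ 2 * L ^ 2 * ‖fourierSum n e x‖ ^ 2 + 2 * L ^ 4) := by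
    intro x
    have h := abs_remainder_le hψ he n hL hB x
    rw [← sq_abs]
    refine (pow_le_pow_left₀ (abs_nonneg _) h 2).trans ?_
    rw [mul_pow]
    gcongr
    -- This is (u + v)² ≤ 2u² + 2v².
    nlinarith [sq_nonneg (2 * A * L * ‖fourierSum n e x‖ - L ^ 2)]
  have hS := intervalIntegral_sq_norm_fourierSum_le n e
  calc ∫ x in (0 : ℝ)..Real.pi, remainder n ψ e x ^ 2
      ≤ ∫ x in (0 : ℝ)..Real.pi, ((n : ℝ)⁻¹) ^ 2
          * (8 * A ^ 2 * L ^ 2 * ‖fourierSum n e x‖ ^ 2 + 2 * L ^ 4) := by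
        refine intervalIntegral.integral_mono hπ.le ?_ ?_ hpt
        · exact ((continuous_remainder hψ n e).pow 2).intervalIntegrable _ _
        · exact Continuous.intervalIntegrable (by fun_prop) _ _
    _ = ((n : ℝ)⁻¹) ^ 2 * (8 * A ^ 2 * L ^ 2 * (∫ x in (0 : ℝ)..Real.pi, ‖fourierSum n e x‖ ^ 2)
          + 2 * L ^ 4 * Real.pi) := by
        rw [intervalIntegral.integral_const_mul, intervalIntegral.integral_add,
          intervalIntegral.integral_const_mul, intervalIntegral.integral_const]
        · simp; ring_nf; simp
        · exact Continuous.intervalIntegrable (by fun_prop) _ _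
        · exact Continuous.intervalIntegrable (by fun_prop) _ _
    -- The 2 is enlarged to 16 only to share the factor 16π.
    _ ≤ ((n : ℝ)⁻¹) ^ 2 * (8 * A ^ 2 * L ^ 2 * (2 * Real.pi * ∑ t ∈ Finset.Icc (1 : ℤ) n, e t ^ 2)
          + 16 * L ^ 4 * Real.pi) := by
        gcongr
        norm_num
    _ = _ := by ring

/-- The Cauchy–Schwarz inequality for the integral of a function against a continuous one. -/
lemma abs_intervalIntegral_mul_le {f g : ℝ → ℝ} (hg : Continuous g)
    (hf : AEStronglyMeasurable f (volume.restrict (Set.Icc 0 Real.pi))) :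
    ENNReal.ofReal |∫ x in (0 : ℝ)..Real.pi, f x * g x|
      ≤ eLpNorm f 2 (volume.restrict (Set.Icc 0 Real.pi))
        * ENNReal.ofReal (Real.sqrt (∫ x in (0 : ℝ)..Real.pi, g x ^ 2)) := by
  have hπ := Real.pi_pos
  rw [intervalIntegral.integral_of_le hπ.le, intervalIntegral.integral_of_le hπ.le,
    ← integral_Icc_eq_integral_Ioc, ← integral_Icc_eq_integral_Ioc, ← Real.norm_eq_abs, ofReal_norm]
  set μ := volume.restrict (Set.Icc 0 Real.pi)
  refine (enorm_integral_le_lintegral_enorm _).trans ?_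
  have h2 : ENNReal.ofReal (Real.sqrt (∫ x, g x ^ 2 ∂μ)) = (∫⁻ x, ‖g x‖ₑ ^ (2 : ℝ) ∂μ) ^ (1 / (2 : ℝ)) := by
    rw [Real.sqrt_eq_rpow, ← ENNReal.ofReal_rpow_of_nonneg
      (integral_nonneg fun x => sq_nonneg _) (by norm_num),
      ofReal_integral_eq_lintegral_ofReal]
    · congr 1
      refine lintegral_congr fun x => ?_
      rw [← ofReal_norm, ENNReal.ofReal_rpow_of_nonneg (norm_nonneg _) (by norm_num),
        Real.norm_eq_abs]
      norm_cast
      rw [sq_abs]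
    · exact ((hg.pow 2).continuousOn.integrableOn_compact isCompact_Icc)
    · exact Filter.Eventually.of_forall fun x => sq_nonneg _
  rw [h2, eLpNorm_eq_lintegral_rpow_enorm_toReal (by norm_num) (by norm_num)]
  simp only [enorm_mul, ENNReal.toReal_ofNat]
  exact ENNReal.lintegral_mul_le_Lp_mul_Lq μ (Real.HolderConjugate.two_two) hf.enorm
    hg.aestronglyMeasurable.enorm

/-! ### Fractional moments of weighted series -/

lemma ennreal_rpow_tsum_le {ι : Type*} (f : ι → ℝ≥0∞) {β : ℝ} (h0 : 0 < β) (h1 : β ≤ 1) :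
    (∑' k, f k) ^ β ≤ ∑' k, f k ^ β := by
  have h := (ENNReal.continuous_rpow_const (y := β)).continuousAt.tendsto.comp
    (ENNReal.summable (f := f)).hasSum
  refine le_of_tendsto h (Filter.Eventually.of_forall fun s => ?_)
  refine le_trans ?_ (ENNReal.sum_le_tsum s)
  exact Finset.le_sum_of_subadditive (fun y : ℝ≥0∞ => y ^ β) (by simp [h0])
    (fun x y => ENNReal.rpow_add_le_add_rpow x y h0.le h1) s f

/-- Subadditivity of y ↦ y^β reduces the series to its marginals; their joint law plays no role. -/
lemma lintegral_rpow_tsum_mul_le {Ω ι : Type*} [Countable ι] [MeasurableSpace Ω]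
    (P : Measure Ω) (w : ι → ℝ≥0∞) {Y : ι → Ω → ℝ≥0∞} (hY : ∀ k, Measurable (Y k))
    {β : ℝ} (h0 : 0 < β) (h1 : β ≤ 1) {K : ℝ≥0∞} (hK : ∀ k, ∫⁻ ω, Y k ω ^ β ∂P ≤ K) :
    ∫⁻ ω, (∑' k, w k * Y k ω) ^ β ∂P ≤ (∑' k, w k ^ β) * K := by
  calc _ ≤ ∫⁻ ω, ∑' k, w k ^ β * Y k ω ^ β ∂P := by
        refine lintegral_mono fun ω => (ennreal_rpow_tsum_le _ h0 h1).trans_eq ?_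
        simp_rw [ENNReal.mul_rpow_of_nonneg _ _ h0.le]
    _ = ∑' k, w k ^ β * ∫⁻ ω, Y k ω ^ β ∂P := by
        rw [lintegral_tsum fun k => (((hY k).pow_const β).const_mul _).aemeasurable]
        simp_rw [lintegral_const_mul _ ((hY _).pow_const β)]
    _ ≤ ∑' k, w k ^ β * K := ENNReal.tsum_le_tsum fun k => by gcongr; exact hK k
    _ = _ := ENNReal.tsum_mul_right

/-! ### Tails and moments of symmetric stable laws -/

section StableLaw

variable {Ω : Type*} [MeasurableSpace Ω] {P : Measure Ω} [IsProbabilityMeasure P]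
  {α : ℝ} {Y : Ω → ℝ}

/-- The polynomial tail of a symmetric stable law. -/
lemma HasStdSymmStableLaw.measure_lt_abs_le (hα : 0 < α) (hY : Measurable Y)
    (h : HasStdSymmStableLaw α Y P) {r : ℝ} (hr : 0 < r) :
    P {ω | r < |Y ω|} ≤ ENNReal.ofReal (2 * 2 ^ α * r ^ (-α)) := by
  have : IsProbabilityMeasure (P.map Y) := Measure.isProbabilityMeasure_map hY.aemeasurable
  have hms : MeasurableSet {x : ℝ | r < |x|} := measurableSet_lt measurable_const (by fun_prop)
  have h1 := measureReal_abs_gt_le_integral_charFun (μ := P.map Y) hr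
  have hP : P {ω | r < |Y ω|} = P.map Y {x | r < |x|} := (Measure.map_apply hY hms).symm
  rw [hP, ← ofReal_measureReal]
  refine ENNReal.ofReal_le_ofReal (h1.trans ?_)
  -- The integrand is 1 − e^{-|t|^α} ≤ |t|^α ≤ (2/r)^α on the whole interval.
  have hb : ‖∫ t in (-2 * r⁻¹)..(2 * r⁻¹), 1 - charFun (P.map Y) t‖
      ≤ (2 * r⁻¹) ^ α * |2 * r⁻¹ - (-2 * r⁻¹)| := by
    refine intervalIntegral.norm_integral_le_of_norm_le_const fun s hs => ?_
    have hri : 0 < r⁻¹ := inv_pos.2 hr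
    rw [Set.uIoc_of_le (by linarith)] at hs
    have hs' : |s| ≤ 2 * r⁻¹ := abs_le.2 ⟨by linarith [hs.1], hs.2⟩
    rw [h s, ← Complex.ofReal_one, ← Complex.ofReal_sub, Complex.norm_real, Real.norm_eq_abs]
    have h2 : 0 ≤ |s| ^ α := by positivity
    have h3 : Real.exp (-(|s| ^ α)) ≤ 1 := Real.exp_le_one_iff.2 (by linarith)
    have h4 := Real.add_one_le_exp (-(|s| ^ α))
    rw [abs_of_nonneg (by linarith)]
    have h5 : |s| ^ α ≤ (2 * r⁻¹) ^ α := Real.rpow_le_rpow (abs_nonneg _) hs' hα.le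
    linarith
  calc _ ≤ 2⁻¹ * r * ((2 * r⁻¹) ^ α * |2 * r⁻¹ - (-2 * r⁻¹)|) := by gcongr
    _ = _ := by
      rw [show 2 * r⁻¹ - (-2 * r⁻¹) = 4 * r⁻¹ by ring, abs_of_nonneg (by positivity),
        Real.mul_rpow (by norm_num) (by positivity), Real.inv_rpow hr.le, Real.rpow_neg hr.le]
      field_simp
      norm_num

lemma HasStdSymmStableLaw.integral_cos (hY : Measurable Y)
    (h : HasStdSymmStableLaw α Y P) (s : ℝ) :
    ∫ ω, Real.cos (s * Y ω) ∂P = Real.exp (-(|s| ^ α)) := by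
  have h1 := h s
  rw [charFun_apply_real, integral_map hY.aemeasurable (by fun_prop)] at h1
  have hint : Integrable (fun ω => Complex.exp (s * Y ω * Complex.I)) P := by
    refine Integrable.of_bound (C := 1) (by fun_prop) (Filter.Eventually.of_forall fun ω => ?_)
    rw [← Complex.ofReal_mul, Complex.norm_exp_ofReal_mul_I]
  have h2 := congrArg Complex.re h1
  rw [Complex.ofReal_re, ← RCLike.re_eq_complex_re, ← integral_re hint] at h2
  rw [← h2]
  refine integral_congr_ae (Filter.Eventually.of_forall fun ω => ?_)
  simp only [RCLike.re_eq_complex_re]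
  rw [← Complex.ofReal_mul, Complex.exp_ofReal_mul_I_re]

/-- The truncated second moment of a symmetric stable law. -/
lemma HasStdSymmStableLaw.lintegral_sq_truncated_le (hY : Measurable Y)
    (h : HasStdSymmStableLaw α Y P) {M : ℝ} (hM : 0 < M) :
    ∫⁻ ω, (if |Y ω| ≤ M then ENNReal.ofReal (Y ω ^ 2) else 0) ∂P
      ≤ ENNReal.ofReal (8 * M ^ (2 - α)) := by
  -- As 1 − cos u ≥ u²/8 for |u| ≤ 1, the truncated square is dominated by a cosine at frequency
  -- 1/M, whose mean is explicit: 1 − exp(−M^{-α}) ≤ M^{-α}.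
  have hpt : ∀ y : ℝ, (if |y| ≤ M then ENNReal.ofReal (y ^ 2) else 0)
      ≤ ENNReal.ofReal (8 * M ^ 2 * (1 - Real.cos (M⁻¹ * y))) := by
    intro y
    split_ifs with hy
    · refine ENNReal.ofReal_le_ofReal ?_
      have h1 : |M⁻¹ * y| ≤ 1 := by
        rw [abs_mul, abs_of_pos (inv_pos.2 hM), inv_mul_le_iff₀ hM]
        linarith
      have hπ3 := Real.pi_gt_three
      have hπ4 := Real.pi_le_four
      have h2 := Real.cos_le_one_sub_mul_cos_sq (x := M⁻¹ * y) (h1.trans (by linarith))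
      have h3 : (1 : ℝ) / 8 ≤ 2 / Real.pi ^ 2 := by
        rw [div_le_div_iff₀ (by norm_num) (by positivity)]
        nlinarith
      have h4 : 1 / 8 * (M⁻¹ * y) ^ 2 ≤ 1 - Real.cos (M⁻¹ * y) := by
        nlinarith [sq_nonneg (M⁻¹ * y)]
      calc y ^ 2 = 8 * M ^ 2 * (1 / 8 * (M⁻¹ * y) ^ 2) := by field_simp
        _ ≤ _ := by gcongr
    · exact zero_le
  have hcos : Integrable (fun ω => Real.cos (M⁻¹ * Y ω)) P := by
    refine Integrable.of_bound (C := 1) ?_ ?_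
    · exact (Real.measurable_cos.comp (hY.const_mul _)).aestronglyMeasurable
    · exact Filter.Eventually.of_forall fun ω => Real.abs_cos_le_one _
  have hint : Integrable (fun ω => 1 - Real.cos (M⁻¹ * Y ω)) P := (integrable_const 1).sub hcos
  refine (lintegral_mono fun ω => hpt (Y ω)).trans ?_
  rw [← ofReal_integral_eq_lintegral_ofReal (hint.const_mul _)
    (Filter.Eventually.of_forall fun ω =>
      mul_nonneg (by positivity) (sub_nonneg.2 (Real.cos_le_one _)))]
  refine ENNReal.ofReal_le_ofReal ?_
  rw [integral_const_mul, integral_sub (integrable_const _) hcos, h.integral_cos hY]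
  have h4 := Real.add_one_le_exp (-(|M⁻¹| ^ α))
  have h5 : |M⁻¹| ^ α = M ^ (-α) := by
    rw [abs_of_pos (inv_pos.2 hM), Real.inv_rpow hM.le, Real.rpow_neg hM.le]
  rw [h5] at h4 ⊢
  have h6 : M ^ (2 - α) = M ^ 2 * M ^ (-α) := by
    rw [sub_eq_add_neg, Real.rpow_add hM]
    norm_cast
  rw [h6]
  have : (0 : ℝ) < M ^ 2 := by positivity
  simp only [integral_const, probReal_univ, smul_eq_mul, mul_one]
  nlinarith

/-- Symmetric `α`-stable laws have moments of every order below `α`. -/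
lemma exists_lintegral_rpow_le (P : Measure Ω) [IsProbabilityMeasure P] {β : ℝ}
    (h0 : 0 < β) (hβ : β < α) :
    ∃ K : ℝ≥0∞, K ≠ ⊤ ∧ ∀ Y : Ω → ℝ, Measurable Y → HasStdSymmStableLaw α Y P →
      ∫⁻ ω, ‖Y ω‖ₑ ^ β ∂P ≤ K := by
  -- Layer-cake formula: the tail is bounded by 1 up to level 1 and by a multiple of t^{-α} beyond.
  -- The pieces are finite because β > 0 and β < α respectively.
  refine ⟨ENNReal.ofReal β * ((∫⁻ t in Set.Ioc (0 : ℝ) 1, ENNReal.ofReal (t ^ (β - 1)))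
    + ∫⁻ t in Set.Ioi (1 : ℝ), ENNReal.ofReal (2 * 2 ^ α * t ^ (β - α - 1))), ?_, ?_⟩
  · have h1 : IntegrableOn (fun t : ℝ => t ^ (β - 1)) (Set.Ioc 0 1) := by
      rw [← intervalIntegrable_iff_integrableOn_Ioc_of_le zero_le_one]
      exact intervalIntegral.intervalIntegrable_rpow' (by linarith)
    have h2 : IntegrableOn (fun t : ℝ => 2 * 2 ^ α * t ^ (β - α - 1)) (Set.Ioi 1) :=
      (integrableOn_Ioi_rpow_of_lt (by linarith) zero_lt_one).const_mul _
    exact ENNReal.mul_ne_top ENNReal.ofReal_ne_top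
      (ENNReal.add_ne_top.2 ⟨h1.lintegral_lt_top.ne, h2.lintegral_lt_top.ne⟩)
  · intro Y hY h
    have h1 : ∀ ω, ‖Y ω‖ₑ ^ β = ENNReal.ofReal (|Y ω| ^ β) := by
      intro ω
      rw [← ofReal_norm, ENNReal.ofReal_rpow_of_nonneg (norm_nonneg _) h0.le, Real.norm_eq_abs]
    simp_rw [h1]
    rw [lintegral_rpow_eq_lintegral_meas_lt_mul P (Filter.Eventually.of_forall fun ω => abs_nonneg _)
      (by fun_prop) h0, ← Set.Ioc_union_Ioi_eq_Ioi (zero_le_one (α := ℝ))]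
    gcongr
    refine (lintegral_union_le _ _ _).trans (add_le_add ?_ ?_)
    · refine lintegral_mono fun t => ?_
      exact mul_le_of_le_one_left zero_le prob_le_one
    · refine setLIntegral_mono' measurableSet_Ioi fun t ht => ?_
      have ht0 : 0 < t := zero_lt_one.trans ht
      refine (mul_le_mul_left (h.measure_lt_abs_le (h0.trans hβ) hY ht0) _).trans_eq ?_
      rw [← ENNReal.ofReal_mul (by positivity), mul_assoc, ← Real.rpow_add ht0]
      ring_nf

end StableLaw

/-- Tightness of the sums of squares at the scale `n ^ (2 / α)`. -/
lemma measure_lt_sum_sq_le {Ω : Type*} [MeasurableSpace Ω] {P : Measure Ω}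
    [IsProbabilityMeasure P] {α : ℝ} (hα : 0 < α) {ε : ℤ → Ω → ℝ} (hε : ∀ t, Measurable (ε t))
    (h : ∀ t, HasStdSymmStableLaw α (ε t) P) {n : ℕ} (hn : 0 < n) {u : ℝ} (hu : 0 < u) :
    P {ω | u ^ 2 * (n : ℝ) ^ (2 / α) < ∑ t ∈ Finset.Icc (1 : ℤ) n, ε t ω ^ 2}
      ≤ ENNReal.ofReal ((2 * 2 ^ α + 8) * u ^ (-α)) := by
  -- Truncation at M = u·n^{1/α} makes n·M^{-α} = u^{-α}. A large sum of squares forces either some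
  -- |ε_t| > M (union bound) or a truncated sum of at least M² (Markov).
  have hn0 : (0 : ℝ) < n := by exact_mod_cast hn
  set M : ℝ := u * (n : ℝ) ^ (1 / α) with hMdef
  have hM : 0 < M := by positivity
  have hM2 : u ^ 2 * (n : ℝ) ^ (2 / α) = M ^ 2 := by
    rw [hMdef, mul_pow, ← Real.rpow_natCast ((n : ℝ) ^ (1 / α)), ← Real.rpow_mul hn0.le]
    congr 2
    push_cast
    ring
  have hMα : (n : ℝ) * M ^ (-α) = u ^ (-α) := by
    rw [hMdef, Real.mul_rpow hu.le (by positivity), ← Real.rpow_mul hn0.le,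
      show 1 / α * -α = -1 by field_simp, Real.rpow_neg_one]
    field_simp
  set T : Ω → ℝ≥0∞ := fun ω => ∑ t ∈ Finset.Icc (1 : ℤ) n,
    (if |ε t ω| ≤ M then ENNReal.ofReal (ε t ω ^ 2) else 0) with hT
  have hmeas : ∀ t, Measurable fun ω =>
      (if |ε t ω| ≤ M then ENNReal.ofReal (ε t ω ^ 2) else 0 : ℝ≥0∞) := by
    intro t
    have := hε t
    exact Measurable.ite (measurableSet_le (by fun_prop) measurable_const) (by fun_prop)
      measurable_const
  have hcard : (Finset.Icc (1 : ℤ) n).card = n := by simp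
  have hsub : {ω | u ^ 2 * (n : ℝ) ^ (2 / α) < ∑ t ∈ Finset.Icc (1 : ℤ) n, ε t ω ^ 2}
      ⊆ (⋃ t ∈ Finset.Icc (1 : ℤ) n, {ω | M < |ε t ω|})
        ∪ {ω | ENNReal.ofReal (M ^ 2) ≤ T ω} := by
    intro ω hω
    by_cases hmax : ∃ t ∈ Finset.Icc (1 : ℤ) n, M < |ε t ω|
    · obtain ⟨t, ht, hlt⟩ := hmax
      exact Or.inl (Set.mem_biUnion ht hlt)
    · push Not at hmax
      refine Or.inr ?_
      have h1 : T ω = ENNReal.ofReal (∑ t ∈ Finset.Icc (1 : ℤ) n, ε t ω ^ 2) := by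
        rw [ENNReal.ofReal_sum_of_nonneg fun t _ => sq_nonneg _]
        exact Finset.sum_congr rfl fun t ht => if_pos (hmax t ht)
      change _ ≤ T ω
      rw [h1, ← hM2]
      exact ENNReal.ofReal_le_ofReal (le_of_lt hω)
  have hA : P (⋃ t ∈ Finset.Icc (1 : ℤ) n, {ω | M < |ε t ω|})
      ≤ ENNReal.ofReal (2 * 2 ^ α * u ^ (-α)) := by
    refine (measure_biUnion_finset_le _ _).trans ?_
    refine (Finset.sum_le_sum fun t _ => (h t).measure_lt_abs_le hα (hε t) hM).trans_eq ?_
    rw [Finset.sum_const, hcard, nsmul_eq_mul, ← ENNReal.ofReal_natCast,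
      ← ENNReal.ofReal_mul hn0.le, ← hMα]
    ring_nf
  have hB : P {ω | ENNReal.ofReal (M ^ 2) ≤ T ω} ≤ ENNReal.ofReal (8 * u ^ (-α)) := by
    have hTm : Measurable T := Finset.measurable_fun_sum _ fun t _ => hmeas t
    have hM2' : 0 < M ^ 2 := by positivity
    refine (meas_ge_le_lintegral_div hTm.aemeasurable
      (by simpa using hM.ne') ENNReal.ofReal_ne_top).trans ?_
    refine ENNReal.div_le_of_le_mul ?_
    rw [lintegral_finsetSum _ fun t _ => hmeas t]
    refine (Finset.sum_le_sum fun t _ => (h t).lintegral_sq_truncated_le (hε t) hM).trans_eq ?_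
    rw [Finset.sum_const, hcard, nsmul_eq_mul, ← ENNReal.ofReal_natCast,
      ← ENNReal.ofReal_mul hn0.le, ← ENNReal.ofReal_mul (by positivity), ← hMα,
      sub_eq_add_neg, Real.rpow_add hM, Real.rpow_ofNat]
    ring_nf
  refine (measure_mono hsub).trans ((measure_union_le _ _).trans ((add_le_add hA hB).trans_eq ?_))
  rw [← ENNReal.ofReal_add (by positivity) (by positivity)]
  ring_nf

/-! ### Summability of powers of the coefficients and their tails -/

section Coefficients

variable {ψ : ℤ → ℝ} {p : ℝ}

lemma summable_of_summable_abs_mul_rpow (hp : 0 ≤ p)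
    (h : Summable fun j : ℤ => |ψ j| * |(j : ℝ)| ^ p) : Summable ψ := by
  refine Summable.of_norm_bounded_eventually h ?_
  filter_upwards [(Set.finite_singleton (0 : ℤ)).compl_mem_cofinite] with j hj
  have hj1 : (1 : ℝ) ≤ |(j : ℝ)| := by exact_mod_cast Int.one_le_abs hj
  exact le_mul_of_one_le_right (abs_nonneg _) (Real.one_le_rpow hj1 hp)

/-- The weighted sum bounds each of its terms, so |ψ_j| ≤ C|j|^{-p} for j ≠ 0, and pβ > 1. -/
lemma tsum_enorm_rpow_ne_top (h : Summable fun j : ℤ => |ψ j| * |(j : ℝ)| ^ p)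
    {β : ℝ} (hβ : 0 < β) (hpβ : 1 < p * β) : ∑' j, ‖ψ j‖ₑ ^ β ≠ ⊤ := by
  set C := ∑' j : ℤ, |ψ j| * |(j : ℝ)| ^ p
  have hs : Summable fun j : ℤ => |ψ j| ^ β := by
    refine Summable.of_norm_bounded_eventually
      ((Real.summable_abs_int_rpow hpβ).mul_left (C ^ β)) ?_
    filter_upwards [(Set.finite_singleton (0 : ℤ)).compl_mem_cofinite] with j hj
    have hj0 : 0 < |(j : ℝ)| := abs_pos.2 (by exact_mod_cast hj)
    have h1 : |ψ j| * |(j : ℝ)| ^ p ≤ C := h.le_tsum j fun i _ => by positivity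
    have h2 : |ψ j| ≤ C * |(j : ℝ)| ^ (-p) := by
      rw [Real.rpow_neg hj0.le, ← div_eq_mul_inv, le_div_iff₀ (by positivity)]
      exact h1
    have hC : 0 ≤ C := tsum_nonneg fun i => by positivity
    rw [Real.norm_eq_abs, abs_of_nonneg (by positivity)]
    refine (Real.rpow_le_rpow (abs_nonneg _) h2 hβ.le).trans_eq ?_
    rw [Real.mul_rpow hC (by positivity), ← Real.rpow_mul hj0.le, neg_mul]
  convert hs.tsum_ofReal_ne_top using 3 with j
  rw [← ofReal_norm, ENNReal.ofReal_rpow_of_nonneg (norm_nonneg _) hβ.le, Real.norm_eq_abs]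

/-- Every j with |j| > k carries weight |j|^p ≥ (k+1)^p. -/
lemma tailWeight_le (hp : 0 ≤ p) (h : Summable fun j : ℤ => |ψ j| * |(j : ℝ)| ^ p) (k : ℕ) :
    tailWeight ψ k ≤ ENNReal.ofReal ((∑' j : ℤ, |ψ j| * |(j : ℝ)| ^ p) * ((k : ℝ) + 1) ^ (-p)) := by
  rw [← tsum_mul_right, ENNReal.ofReal_tsum_of_nonneg (fun j => by positivity) (h.mul_right _)]
  refine ENNReal.tsum_le_tsum fun j => ?_
  split_ifs with hk
  · rw [← ofReal_norm, Real.norm_eq_abs]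
    refine ENNReal.ofReal_le_ofReal ?_
    have hj : (k : ℝ) + 1 ≤ |(j : ℝ)| := by
      rw [← Int.cast_abs, Int.abs_eq_natAbs]
      exact_mod_cast hk
    have hk0 : (0 : ℝ) < (k : ℝ) + 1 := by positivity
    rw [mul_assoc, Real.rpow_neg hk0.le, ← div_eq_mul_inv]
    refine le_mul_of_one_le_right (abs_nonneg _) ?_
    rw [one_le_div (by positivity)]
    exact Real.rpow_le_rpow hk0.le hj hp
  · exact zero_le

lemma tsum_tailWeight_rpow_ne_top (hp : 0 ≤ p)
    (h : Summable fun j : ℤ => |ψ j| * |(j : ℝ)| ^ p)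
    {β : ℝ} (hβ : 0 < β) (hpβ : 1 < p * β) : ∑' k, tailWeight ψ k ^ β ≠ ⊤ := by
  set C := ∑' j : ℤ, |ψ j| * |(j : ℝ)| ^ p with hCdef
  have hC : 0 ≤ C := tsum_nonneg fun i => by positivity
  have hs : Summable fun k : ℕ => C ^ β * (((k + 1 : ℕ) : ℝ) ^ (p * β))⁻¹ :=
    ((summable_nat_add_iff 1).2 (Real.summable_nat_rpow_inv.2 hpβ)).mul_left _
  refine ne_top_of_le_ne_top hs.tsum_ofReal_ne_top (ENNReal.tsum_le_tsum fun k => ?_)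
  refine (ENNReal.rpow_le_rpow (tailWeight_le hp h k) hβ.le).trans_eq ?_
  have hk0 : (0 : ℝ) < (k : ℝ) + 1 := by positivity
  rw [ENNReal.ofReal_rpow_of_nonneg (by positivity) hβ.le, Real.mul_rpow hC (by positivity),
    ← Real.rpow_mul hk0.le, neg_mul, Real.rpow_neg hk0.le]
  push_cast
  rfl

end Coefficients

/-! ### Almost sure convergence and tightness of the edge sum -/

section Noise

variable {Ω : Type*} [MeasurableSpace Ω] {P : Measure Ω} {ε : ℤ → Ω → ℝ} {ψ : ℤ → ℝ}
  {β : ℝ} {K : ℝ≥0∞}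

/-- The sum of absolute values has a finite β-th moment, hence is almost surely finite. -/
lemma ae_summable_linearFilter (hε : ∀ t, Measurable (ε t)) (h0 : 0 < β) (h1 : β ≤ 1)
    (hK : ∀ t, ∫⁻ ω, ‖ε t ω‖ₑ ^ β ∂P ≤ K) (hK' : K ≠ ⊤) (hψ : ∑' j, ‖ψ j‖ₑ ^ β ≠ ⊤) (t : ℤ) :
    ∀ᵐ ω ∂P, Summable fun j : ℤ => ψ j * ε (t - j) ω := by
  have hm : Measurable fun ω => (∑' j, ‖ψ j‖ₑ * ‖ε (t - j) ω‖ₑ) ^ β :=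
    (Measurable.tsum fun j => (hε _).enorm.const_mul _).pow_const β
  have hle := lintegral_rpow_tsum_mul_le P (fun j => ‖ψ j‖ₑ)
    (Y := fun j ω => ‖ε (t - j) ω‖ₑ) (fun j => (hε _).enorm) h0 h1 (fun j => hK (t - j))
  filter_upwards [ae_lt_top hm (ne_top_of_le_ne_top (ENNReal.mul_ne_top hψ hK') hle)] with ω hω
  rw [ENNReal.rpow_lt_top_iff_of_pos h0] at hω
  refine Summable.of_nnnorm (ENNReal.tsum_coe_ne_top_iff_summable.1 ?_)
  convert hω.ne using 3 with j
  exact enorm_mul _ _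

lemma measurable_edgeTerm (hε : ∀ t, Measurable (ε t)) (n k : ℕ) :
    Measurable fun ω => edgeTerm n (fun t => ε t ω) k :=
  (((hε _).enorm.add (hε _).enorm).add ((hε _).enorm.add (hε _).enorm))

lemma lintegral_edgeTerm_rpow_le (hε : ∀ t, Measurable (ε t)) (h0 : 0 < β) (h1 : β ≤ 1)
    (hK : ∀ t, ∫⁻ ω, ‖ε t ω‖ₑ ^ β ∂P ≤ K) (n k : ℕ) :
    ∫⁻ ω, edgeTerm n (fun t => ε t ω) k ^ β ∂P ≤ K + K + (K + K) := by
  have hm : ∀ t, Measurable fun ω => ‖ε t ω‖ₑ ^ β := fun t => (hε t).enorm.pow_const β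
  have hadd := fun a b : ℝ≥0∞ => ENNReal.rpow_add_le_add_rpow a b h0.le h1
  calc _ ≤ ∫⁻ ω, (‖ε (-k) ω‖ₑ ^ β + ‖ε (n - k) ω‖ₑ ^ β
        + (‖ε (1 + k) ω‖ₑ ^ β + ‖ε (n + 1 + k) ω‖ₑ ^ β)) ∂P := by
        refine lintegral_mono fun ω => (hadd _ _).trans ?_
        gcongr <;> exact hadd _ _
    _ ≤ _ := by
        rw [lintegral_add_left (by fun_prop), lintegral_add_left (hm _), lintegral_add_left (hm _)]
        gcongr <;> exact hK _

/-- Markov's inequality for the β-th moment. C does not depend on n, which is what gives tightness.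
-/
lemma measure_lt_edgeSum_le (hε : ∀ t, Measurable (ε t)) (h0 : 0 < β) (h1 : β ≤ 1)
    (hK : ∀ t, ∫⁻ ω, ‖ε t ω‖ₑ ^ β ∂P ≤ K) (hK' : K ≠ ⊤)
    (hψ : ∑' k, tailWeight ψ k ^ β ≠ ⊤) :
    ∃ C : ℝ, ∀ (n : ℕ) (L : ℝ), 0 < L →
      P {ω | ENNReal.ofReal L < edgeSum n ψ (fun t => ε t ω)} ≤ ENNReal.ofReal (C * L ^ (-β)) := by
  set B := (∑' k, tailWeight ψ k ^ β) * (K + K + (K + K)) with hBdef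
  have hB : B ≠ ⊤ := ENNReal.mul_ne_top hψ (by simp [hK'])
  refine ⟨B.toReal, fun n L hL => ?_⟩
  have hle : ∫⁻ ω, edgeSum n ψ (fun t => ε t ω) ^ β ∂P ≤ B :=
    lintegral_rpow_tsum_mul_le P (tailWeight ψ) (Y := fun k ω => edgeTerm n (fun t => ε t ω) k)
      (measurable_edgeTerm hε n) h0 h1 (lintegral_edgeTerm_rpow_le hε h0 h1 hK n)
  have hm : Measurable fun ω => edgeSum n ψ (fun t => ε t ω) ^ β :=
    (Measurable.tsum fun k => (measurable_edgeTerm hε n k).const_mul _).pow_const β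
  have hL' : 0 < L ^ β := by positivity
  calc _ ≤ P {ω | ENNReal.ofReal (L ^ β) ≤ edgeSum n ψ (fun t => ε t ω) ^ β} := by
        refine measure_mono fun ω hω => ?_
        rw [Set.mem_ofPred_eq, ← ENNReal.ofReal_rpow_of_nonneg hL.le h0.le]
        exact ENNReal.rpow_le_rpow (le_of_lt hω) h0.le
    _ ≤ (∫⁻ ω, edgeSum n ψ (fun t => ε t ω) ^ β ∂P) / ENNReal.ofReal (L ^ β) :=
        meas_ge_le_lintegral_div hm.aemeasurable (by simpa using hL') ENNReal.ofReal_ne_top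
    _ ≤ B / ENNReal.ofReal (L ^ β) := by gcongr
    _ = _ := by
        rw [Real.rpow_neg hL.le, ← div_eq_mul_inv, ENNReal.ofReal_div_of_pos hL',
          ENNReal.ofReal_toReal hB]

end Noise

/-! ### Assembly of the bounds and convergence in probability -/

/-- On the event that the edge sum and the sum of squares are of their typical order, the
normalised supremum is at most a constant times `(log n) ^ (-1 / α)`. -/
lemma normalised_iSup_le {α : ℝ} {ψ e : ℤ → ℝ} (hψ : Summable ψ)
    (he : ∀ t : ℤ, Summable fun j : ℤ => ψ j * e (t - j)) {F : Set (ℝ → ℝ)}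
    (hF : ∀ f ∈ F, AEStronglyMeasurable f (volume.restrict (Set.Icc 0 Real.pi)))
    {n : ℕ} (hn : 2 ≤ n) {L : ℝ} (hL : 0 ≤ L) (hB : edgeSum n ψ e ≤ ENNReal.ofReal L)
    (hQ : ∑ t ∈ Finset.Icc (1 : ℤ) n, e t ^ 2 ≤ L ^ 2 * (n : ℝ) ^ (2 / α)) (hα : 0 < α) :
    ENNReal.ofReal ((n : ℝ) / ((n : ℝ) * Real.log n) ^ (1 / α)) *
        ⨆ f ∈ F, ENNReal.ofReal |∫ x in (0 : ℝ)..Real.pi, f x * remainder n ψ e x|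
      ≤ ENNReal.ofReal (L ^ 2 * Real.sqrt (16 * Real.pi * ((∑' j, |ψ j|) ^ 2 + 1))
          * Real.log n ^ (-(1 / α)))
        * ⨆ f ∈ F, eLpNorm f 2 (volume.restrict (Set.Icc 0 Real.pi)) := by
  set A := ∑' j, |ψ j|
  set D := Real.sqrt (16 * Real.pi * (A ^ 2 + 1)) with hD
  have hn1 : (1 : ℝ) < n := by exact_mod_cast hn
  have hn0 : (0 : ℝ) < n := by linarith
  have hlog : 0 < Real.log n := Real.log_pos hn1
  have hsqrt : Real.sqrt (∫ x in (0 : ℝ)..Real.pi, remainder n ψ e x ^ 2)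
      ≤ (n : ℝ)⁻¹ * (L ^ 2 * D * (n : ℝ) ^ (1 / α)) := by
    refine Real.sqrt_le_iff.2 ⟨by positivity, ?_⟩
    refine (intervalIntegral_sq_remainder_le hψ he n hL hB).trans ?_
    have hpow : ((n : ℝ) ^ (1 / α)) ^ 2 = (n : ℝ) ^ (2 / α) := by
      rw [← Real.rpow_natCast, ← Real.rpow_mul hn0.le]
      congr 1
      push_cast
      ring
    -- Lets the term L⁴ be absorbed into L⁴·n^{2/α}.
    have hone : 1 ≤ (n : ℝ) ^ (2 / α) := Real.one_le_rpow hn1.le (by positivity)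
    rw [mul_pow, mul_pow, mul_pow, hpow, hD, Real.sq_sqrt (by positivity)]
    refine mul_le_mul_of_nonneg_left ?_ (by positivity)
    calc _ ≤ 16 * Real.pi * (L ^ 2 * A ^ 2 * (L ^ 2 * (n : ℝ) ^ (2 / α))
          + L ^ 4 * (n : ℝ) ^ (2 / α)) := by
          gcongr
          exact le_mul_of_one_le_right (by positivity) hone
      _ = _ := by ring
  have hsup : ⨆ f ∈ F, ENNReal.ofReal |∫ x in (0 : ℝ)..Real.pi, f x * remainder n ψ e x|
      ≤ (⨆ f ∈ F, eLpNorm f 2 (volume.restrict (Set.Icc 0 Real.pi)))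
        * ENNReal.ofReal ((n : ℝ)⁻¹ * (L ^ 2 * D * (n : ℝ) ^ (1 / α))) := by
    refine iSup₂_le fun f hf => ?_
    refine (abs_intervalIntegral_mul_le (continuous_remainder hψ n e) (hF f hf)).trans ?_
    gcongr
    exact le_iSup₂ (f := fun f (_ : f ∈ F) => eLpNorm f 2 (volume.restrict (Set.Icc 0 Real.pi))) f hf
  refine (mul_le_mul_right hsup _).trans_eq ?_
  rw [mul_comm (iSup _), ← mul_assoc, ← ENNReal.ofReal_mul (by positivity)]
  congr 2
  -- Both n·n⁻¹ and the powers n^{1/α} cancel, leaving only the logarithm.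
  rw [Real.mul_rpow hn0.le hlog.le, Real.rpow_neg hlog.le]
  field_simp

end LinearProcess

end

theorem mainTheorem7 {Ω : Type*} [MeasurableSpace Ω]
    (P : MeasureTheory.Measure Ω) [MeasureTheory.IsProbabilityMeasure P]
    (α : ℝ) (hα0 : 0 < α) (hα2 : α < 2)
    (ε : ℤ → Ω → ℝ) (hε_meas : ∀ t, Measurable (ε t))
    (hε_indep : ProbabilityTheory.iIndepFun ε P)
    (hε_law : ∀ t, LinearProcess.HasStdSymmStableLaw α (ε t) P)
    (ψ : ℤ → ℝ) (τ : ℝ) (hτ : 0 < τ)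
    (hψ : Summable fun j : ℤ =>
      |ψ j| * |(j : ℝ)| ^ (2 / α) *
        (1 + Real.posLog |(j : ℝ)|) ^ ((4 - α) / (2 * α) + τ))
    (F : Set (ℝ → ℝ))
    (hF_meas : ∀ f ∈ F, MeasureTheory.AEStronglyMeasurable f
      (MeasureTheory.volume.restrict (Set.Icc 0 Real.pi)))
    (hF_bdd : (⨆ f ∈ F, MeasureTheory.eLpNorm f 2
      (MeasureTheory.volume.restrict (Set.Icc 0 Real.pi))) < ⊤) :
    -- the series defining `X_t` and the transfer function converge (absolutely)
    (∀ t : ℤ, ∀ᵐ ω ∂P, Summable fun j : ℤ => ψ j * ε (t - j) ω) ∧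
    (∀ x : ℝ, Summable fun j : ℤ => (ψ j : ℂ) * Complex.exp (-(Complex.I * x * j))) ∧
    -- the integrals are well defined
    (∀ (n : ℕ) (ω : Ω), ∀ f ∈ F, IntervalIntegrable
      (fun x => f x * LinearProcess.remainder n ψ (fun t => ε t ω) x)
      MeasureTheory.volume 0 Real.pi) ∧
    -- the uniform convergence in probability
    (∀ δ : ℝ, 0 < δ → Filter.Tendsto
      (fun n : ℕ => P {ω | ENNReal.ofReal δ ≤
        ENNReal.ofReal ((n : ℝ) / ((n : ℝ) * Real.log n) ^ (1 / α)) *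
          ⨆ f ∈ F, ENNReal.ofReal |∫ x in (0 : ℝ)..Real.pi,
            f x * LinearProcess.remainder n ψ (fun t => ε t ω) x|})
      Filter.atTop (nhds 0)) := by
  -- The logarithmic weight is at least 1, so it can be dropped.
  have hψ' : Summable fun j : ℤ => |ψ j| * |(j : ℝ)| ^ (2 / α) := by
    refine Summable.of_nonneg_of_le (fun j => by positivity) (fun j => ?_) hψ
    refine le_mul_of_one_le_right (by positivity) (Real.one_le_rpow ?_ ?_)
    · linarith [Real.posLog_nonneg (x := |(j : ℝ)|)]
    · have : 0 < (4 - α) / (2 * α) := div_pos (by linarith) (by linarith)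
      linarith
  have hp : 0 ≤ 2 / α := by positivity
  have hψs := LinearProcess.summable_of_summable_abs_mul_rpow hp hψ'
  -- β < α gives moments, β < 1 subadditivity, and β > α/2 the convergence of ∑ k^{-2β/α}; the
  -- interval is nonempty because 0 < α < 2.
  obtain ⟨β, hβ1, hβ2⟩ : ∃ β, α / 2 < β ∧ β < min α 1 :=
    exists_between (lt_min (by linarith) (by linarith))
  obtain ⟨hβα, hβ1'⟩ := lt_min_iff.1 hβ2
  have hβ0 : 0 < β := by linarith
  have hpβ : 1 < 2 / α * β := by
    rw [div_mul_eq_mul_div, one_lt_div hα0]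
    linarith
  obtain ⟨K, hK, hKle⟩ := LinearProcess.exists_lintegral_rpow_le P hβ0 hβα
  have hKε : ∀ t, ∫⁻ ω, ‖ε t ω‖ₑ ^ β ∂P ≤ K := fun t => hKle _ (hε_meas t) (hε_law t)
  have hsum := LinearProcess.ae_summable_linearFilter hε_meas hβ0 hβ1'.le hKε hK
    (LinearProcess.tsum_enorm_rpow_ne_top hψ' hβ0 hpβ)
  refine ⟨hsum, LinearProcess.summable_transfer hψs, ?_, ?_⟩
  · intro n ω f hf
    rw [intervalIntegrable_iff_integrableOn_Icc_of_le Real.pi_pos.le]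
    have hfL : MeasureTheory.MemLp f 2 (MeasureTheory.volume.restrict (Set.Icc 0 Real.pi)) :=
      ⟨hF_meas f hf, (le_iSup₂ (f := fun f (_ : f ∈ F) => MeasureTheory.eLpNorm f 2
        (MeasureTheory.volume.restrict (Set.Icc 0 Real.pi))) f hf).trans_lt hF_bdd⟩
    exact MeasureTheory.IntegrableOn.mul_continuousOn (hfL.integrable (by norm_num))
      (LinearProcess.continuous_remainder hψs n _).continuousOn isCompact_Icc
  · intro δ hδ
    obtain ⟨C, hC⟩ := LinearProcess.measure_lt_edgeSum_le hε_meas hβ0 hβ1'.le hKε hK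
      (LinearProcess.tsum_tailWeight_rpow_ne_top hp hψ' hβ0 hpβ)
    rw [ENNReal.tendsto_nhds_zero]
    intro η hη
    have hlim : Filter.Tendsto (fun L : ℝ => ENNReal.ofReal (C * L ^ (-β))
        + ENNReal.ofReal ((2 * 2 ^ α + 8) * L ^ (-α))) Filter.atTop (nhds 0) := by
      have h1 := ENNReal.tendsto_ofReal ((tendsto_rpow_neg_atTop hβ0).const_mul C)
      have h2 := ENNReal.tendsto_ofReal
        ((tendsto_rpow_neg_atTop hα0).const_mul (2 * 2 ^ α + 8))
      simpa using h1.add h2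
    -- L is fixed before n, making both exceptional events improbable uniformly in n; only then is n
    -- taken large, so that the deterministic bound falls below δ.
    obtain ⟨L, hLη, hL⟩ := ((ENNReal.tendsto_nhds_zero.1 hlim η hη).and
      (Filter.eventually_gt_atTop 0)).exists
    set M := ⨆ f ∈ F, MeasureTheory.eLpNorm f 2
      (MeasureTheory.volume.restrict (Set.Icc 0 Real.pi))
    set D := L ^ 2 * Real.sqrt (16 * Real.pi * ((∑' j, |ψ j|) ^ 2 + 1))
    have hsmall : Filter.Tendsto (fun n : ℕ =>
        ENNReal.ofReal (D * Real.log n ^ (-(1 / α))) * M) Filter.atTop (nhds 0) := by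
      have h1 : Filter.Tendsto (fun n : ℕ => Real.log n ^ (-(1 / α))) Filter.atTop (nhds 0) :=
        (tendsto_rpow_neg_atTop (by positivity)).comp
          (Real.tendsto_log_atTop.comp tendsto_natCast_atTop_atTop)
      have h2 := ENNReal.Tendsto.mul_const (b := M)
        (ENNReal.tendsto_ofReal (h1.const_mul D)) (Or.inr hF_bdd.ne)
      simpa using h2
    have hδ' : (0 : ENNReal) < ENNReal.ofReal δ := ENNReal.ofReal_pos.2 hδ
    filter_upwards [hsmall.eventually (gt_mem_nhds hδ'), Filter.eventually_ge_atTop 2] with n hnδ hn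
    refine le_trans ?_ hLη
    have hae : ∀ᵐ ω ∂P, ∀ t : ℤ, Summable fun j : ℤ => ψ j * ε (t - j) ω :=
      MeasureTheory.ae_all_iff.2 hsum
    refine le_trans ?_ (add_le_add (hC n L hL)
      (LinearProcess.measure_lt_sum_sq_le hα0 hε_meas hε_law (by omega : 0 < n) hL))
    -- Almost everywhere inclusion suffices, so measurability of the supremum over a possibly
    -- uncountable F is not required.
    refine le_trans (MeasureTheory.measure_mono_ae ?_) (MeasureTheory.measure_union_le _ _)
    filter_upwards [hae] with ω hω hωδ
    by_contra hnot
    have hnot' := not_or.1 hnot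
    refine absurd (le_trans hωδ ?_) hnδ.not_ge
    exact LinearProcess.normalised_iSup_le hψs hω hF_meas hn hL.le (not_lt.1 hnot'.1)
      (not_lt.1 hnot'.2) hα0
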